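/- \textbf{Setting.} Let $d\ge 0$, let $E\subseteq\mathbb R^d$ be closed, and let $E^\Delta$ be its one-point compactification ($E^\Delta=E$ if $E$ is compact). Write $C_\Delta(E^k)$ for the restrictions to $E^k$ of functions in $C((E^\Delta)^k)$, $\widehat C_\Delta(E^k)$ for its subspace of symmetric functions, and identify $C_\Delta(E)$ with $C(E^\Delta)$. Let $D=\{f|_E: f\in\mathbb R+C_c^\infty(\mathbb R^d)\}$ and $D\otimes D=\operatorname{span}\{g\otimes g:g\in D\}$, where $(g\otimes g)(x,y)=g(x)g(y)$. Let $M(E)$ be the finite signed measures on $E$, $M_1(E)$ the probability measures, $P$ the space of polynomials $\nu\mapsto\sum_{k=0}^m\int g_k\,d\nu^k$ on $M(E)$ with $g_k\in\widehat C_\Delta(E^k)$, and $P^D=\operatorname{span}\{1,\ (\int g\,d\nu)^k: k\ge1,\ g\in D\}$. Put $\partial_xp(\nu)=\frac{d}{d\varepsilon}p(\nu+\varepsilon\delta_x)|_{\varepsilon=0}$, $\partial p(\nu)=(x\mapsto \partial_xp(\nu))$, $\partial^2p(\nu)=((x,y)\mapsto\partial_x\partial_yp(\nu))$ and $\Psi(g)(x,y)=\tfrac12\big(g(x,x)+g(y,y)-2g(x,y)\big)$.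 An operator $\mathcal A$ satisfies the positive maximum principle on $S$ if $\mathcal Af(x)\le0$ whenever $f$ is in its domain, $x\in S$ and $f(x)=\sup_Sf\ge0$. A linear $B:D\to C_\Delta(E)$ is $E$-conservative if there are $f_n\in D\cap C_0(E)$ with $f_n\to1$ on $E$ and $(Bf_n)^-\to0$ on $E^\Delta$, both boundedly and pointwise. Let $\Sigma^d(E)$ be the set of $\tau:\mathbb R^d\to\mathbb R^{d\times d}$ with components in $C_\Delta(\mathbb R^d)\cap C^1(\mathbb R^d)$ such that $\tau(x)^\top\nabla f(x)=0$ whenever $f\in\mathbb R+C_c^\infty(\mathbb R^d)$, $x\in E$ and $f(x)=\max_Ef$. \textbf{Theorem.} Let $L:P^D\to P$ be linear with $$Lp(\nu)=\int B(\partial p(\nu))\,d\nu+\tfrac12\int Q(\partial^2p(\nu))\,d\nu^2,\qquad p\in P^D,\ \nu\in M_1(E),$$ for linear operators $B:D\to C_\Delta(E)$ and $Q:D\otimes D\to\widehat C_\Delta(E^2)$. Suppose that (i) $B$ is $E$-conservative and $B1=0$; (ii) for all $g\in D$, $Q(g\otimes g)=\alpha\,\Psi(g\otimes g)+\operatorname{tr}\big((\tau^\top\nabla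 g)\otimes(\tau^\top\nabla g)^\top\big)$ on $E^2$, that is, the second term at $(x,y)$ is $\sum_{i=1}^d(\tau_i^\top\nabla g)(x)\,(\tau_i^\top\nabla g)(y)$, where $\tau\in\Sigma^d(E)$ has columns $\tau_1,\dots,\tau_d$ and $\alpha:E^2\to\mathbb R$ is nonnegative and symmetric; (iii) for some real $c\ge\frac12$ (for instance $c=1$ or $c=\frac12$), $B-c\sum_{i=1}^d(\tau_i^\top\nabla)^2$ satisfies the positive maximum principle on $E$. Then there are operators $A_1,\dots,A_d$ on $C_\Delta(E)$ with $A_ig=\tau_i^\top\nabla g$ for $g\in D$, such that the hypotheses of the existence theorem for probability-valued polynomial diffusions hold, namely: $D$ is a dense linear subspace of $C_\Delta(E)$ containing $1$; $L$ has the above form; $B$ is $E$-conservative and $B1=0$; $\alpha$ is nonnegative and symmetric; each $A_i$ is the generator of a strongly continuous group of positive isometries of $C_\Delta(E)$, and its domain contains both $D$ and $A_i(D)$; $Q(g)=\alpha\Psi(g)+\sum_{i=1}^d(A_i\otimes A_i)(g)$ on $E^2$ for every $g\in D\otimes D$, where $A_i\otimes A_i$ is the linear operator on $D\otimes D$ with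 $(A_i\otimes A_i)(g\otimes g)=A_ig\otimes A_ig$; and $B-\frac12\sum_{i=1}^dA_i^2$ (with domain $D$) satisfies the positive maximum principle on $E^\Delta$. -/

import Mathlib

open Filter Topology MeasureTheory

namespace MeasureValued

section General

/-- `E^Δ`: the one-point compactification of `E` if `E` is noncompact, and `E` itself if `E` is
compact (then the point at infinity of `OnePoint E` is isolated and is not in the closure of `E`). -/
abbrev EDelta (E : Type*) [TopologicalSpace E] : Type _ :=
  {x : OnePoint E // x ∈ closure (Set.range ((↑) : E → OnePoint E))}

instance (E : Type*) [TopologicalSpace E] : CompactSpace (EDelta E) :=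
  isCompact_iff_compactSpace.mp isClosed_closure.isCompact

/-- The inclusion `E ⊆ E^Δ`. -/
def incl {E : Type*} [TopologicalSpace E] (x : E) : EDelta E :=
  ⟨(x : OnePoint E), subset_closure (Set.mem_range_self x)⟩

/-- `C_Δ(E)`, identified with `C(E^Δ)`. -/
abbrev CDelta (E : Type*) [TopologicalSpace E] : Type _ := C(EDelta E, ℝ)

/-- `Ĉ_Δ(E^k)`, identified with the symmetric functions in `C((E^Δ)^k)`. -/
def SymCDelta (E : Type*) [TopologicalSpace E] (k : ℕ) :
    Submodule ℝ C(Fin k → EDelta E, ℝ) where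
  carrier := {f | ∀ (σ : Equiv.Perm (Fin k)) (v : Fin k → EDelta E), f (v ∘ σ) = f v}
  add_mem' := by
    intro f g hf hg σ v
    simp only [ContinuousMap.add_apply]
    rw [hf σ v, hg σ v]
  zero_mem' := by
    intro σ v
    rfl
  smul_mem' := by
    intro c f hf σ v
    simp only [ContinuousMap.smul_apply]
    rw [hf σ v]

/-- `g ⊗ g`, the function `(x, y) ↦ g x * g y` in `C((E^Δ)^2)`. -/
def tensorSelf {E : Type*} [TopologicalSpace E] (g : CDelta E) : C(Fin 2 → EDelta E, ℝ) where
  toFun v := g (v 0) * g (v 1)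
  continuous_toFun := by fun_prop

/-- `D ⊗ D = span {g ⊗ g : g ∈ D}`. -/
def tensorSpace {E : Type*} [TopologicalSpace E] (D : Submodule ℝ (CDelta E)) :
    Submodule ℝ C(Fin 2 → EDelta E, ℝ) :=
  Submodule.span ℝ (Set.range fun g : D => tensorSelf (g : CDelta E))

/-- `g ⊗ g` as an element of `D ⊗ D`, for `g ∈ D`. -/
def tensorSelfIn {E : Type*} [TopologicalSpace E] (D : Submodule ℝ (CDelta E)) (g : D) :
    tensorSpace D :=
  ⟨tensorSelf (g : CDelta E), Submodule.subset_span (Set.mem_range_self g)⟩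

/-- The linear extension of `g ↦ g ⊗ g` to formal linear combinations. -/
noncomputable def tensorComb {E : Type*} [TopologicalSpace E] (D : Submodule ℝ (CDelta E)) :
    (D →₀ ℝ) →ₗ[ℝ] tensorSpace D :=
  Finsupp.linearCombination ℝ (tensorSelfIn D)

theorem tensorComb_surjective {E : Type*} [TopologicalSpace E] (D : Submodule ℝ (CDelta E)) :
    Function.Surjective (tensorComb D) := by
  rintro ⟨h, hh⟩
  have h1 : h ∈ LinearMap.range
      (Finsupp.linearCombination ℝ (fun g : D => tensorSelf (g : CDelta E))) := by
    rw [Finsupp.range_linearCombination]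
    exact hh
  obtain ⟨c, hc⟩ := h1
  refine ⟨c, Subtype.ext ?_⟩
  change _ = h
  rw [← hc]
  simp [tensorComb, Finsupp.linearCombination_apply, Finsupp.sum, tensorSelfIn]

/-- The linear extension of `g ↦ A g ⊗ A g` to formal linear combinations. -/
noncomputable def tensorCombMap {E : Type*} [TopologicalSpace E] {D : Submodule ℝ (CDelta E)}
    (A : D →ₗ[ℝ] CDelta E) : (D →₀ ℝ) →ₗ[ℝ] C(Fin 2 → EDelta E, ℝ) :=
  Finsupp.linearCombination ℝ (fun g : D => tensorSelf (A g))

theorem tensorComb_ker_le {E : Type*} [TopologicalSpace E] {D : Submodule ℝ (CDelta E)}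
    (A : D →ₗ[ℝ] CDelta E) :
    LinearMap.ker (tensorComb D) ≤ LinearMap.ker (tensorCombMap A) := by
  intro c hc
  rw [LinearMap.mem_ker] at hc ⊢
  have h0 : ∀ x y : EDelta E, ∑ g ∈ c.support, c g * ((g : CDelta E) x * (g : CDelta E) y) = 0 := by
    intro x y
    have := congrArg (fun h : tensorSpace D => (h : C(Fin 2 → EDelta E, ℝ)) ![x, y]) hc
    simpa [tensorComb, Finsupp.linearCombination_apply, Finsupp.sum, tensorSelfIn,
      tensorSelf] using this
  have h1 : ∀ x y : EDelta E, ∑ g ∈ c.support, c g * (A g x * (g : CDelta E) y) = 0 := by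
    intro x y
    have hz : ∑ g ∈ c.support, (c g * (g : CDelta E) y) • g = 0 := by
      apply Subtype.ext
      ext z
      have := h0 z y
      simp only [Submodule.coe_sum, Submodule.coe_smul, ContinuousMap.coe_sum, Finset.sum_apply,
        ContinuousMap.coe_smul, Pi.smul_apply, smul_eq_mul, ZeroMemClass.coe_zero,
        ContinuousMap.zero_apply]
      rw [← this]
      exact Finset.sum_congr rfl fun g _ => by ring
    have h2 := congrArg (fun h => A h x) hz
    simp only [map_sum, map_smul, ContinuousMap.coe_sum, Finset.sum_apply,
      ContinuousMap.coe_smul, Pi.smul_apply, smul_eq_mul, map_zero,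
      ContinuousMap.zero_apply] at h2
    rw [← h2]
    exact Finset.sum_congr rfl fun g _ => by ring
  have h3 : ∀ x y : EDelta E, ∑ g ∈ c.support, c g * (A g x * A g y) = 0 := by
    intro x y
    have hz : ∑ g ∈ c.support, (c g * A g x) • g = 0 := by
      apply Subtype.ext
      ext z
      have := h1 x z
      simp only [Submodule.coe_sum, Submodule.coe_smul, ContinuousMap.coe_sum, Finset.sum_apply,
        ContinuousMap.coe_smul, Pi.smul_apply, smul_eq_mul, ZeroMemClass.coe_zero,
        ContinuousMap.zero_apply]
      rw [← this]
      exact Finset.sum_congr rfl fun g _ => by ring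
    have h2 := congrArg (fun h => A h y) hz
    simp only [map_sum, map_smul, ContinuousMap.coe_sum, Finset.sum_apply,
      ContinuousMap.coe_smul, Pi.smul_apply, smul_eq_mul, map_zero,
      ContinuousMap.zero_apply] at h2
    rw [← h2]
    exact Finset.sum_congr rfl fun g _ => by ring
  ext v
  simpa [tensorCombMap, Finsupp.linearCombination_apply, Finsupp.sum, tensorSelf] using
    h3 (v 0) (v 1)

/-- `A ⊗ A` on `D ⊗ D`: the linear operator determined by `(A ⊗ A)(g ⊗ g) = A g ⊗ A g`. -/
noncomputable def tensorOp {E : Type*} [TopologicalSpace E] {D : Submodule ℝ (CDelta E)}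
    (A : D →ₗ[ℝ] CDelta E) : tensorSpace D →ₗ[ℝ] C(Fin 2 → EDelta E, ℝ) :=
  (Submodule.liftQ _ (tensorCombMap A) (tensorComb_ker_le A)).comp
    ((tensorComb D).quotKerEquivOfSurjective (tensorComb_surjective D)).symm.toLinearMap

theorem tensorOp_tensorSelfIn {E : Type*} [TopologicalSpace E] {D : Submodule ℝ (CDelta E)}
    (A : D →ₗ[ℝ] CDelta E) (g : D) :
    tensorOp A (tensorSelfIn D g) = tensorSelf (A g) := by
  have h : ((tensorComb D).quotKerEquivOfSurjective (tensorComb_surjective D)).symm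
      (tensorSelfIn D g) = Submodule.Quotient.mk (Finsupp.single g 1) := by
    rw [LinearEquiv.symm_apply_eq]
    change tensorSelfIn D g = tensorComb D (Finsupp.single g 1)
    simp [tensorComb]
  simp only [tensorOp, LinearMap.comp_apply, LinearEquiv.coe_coe, h, Submodule.liftQ_apply]
  simp [tensorCombMap]

/-- `Ψ(g)(x, y) = (g(x, x) + g(y, y) - 2 g(x, y)) / 2`. -/
noncomputable def Psi {E : Type*} (g : E → E → ℝ) (x y : E) : ℝ :=
  (g x x + g y y - 2 * g x y) / 2

/-! ### Polynomials on the space `M(E)` of signed measures -/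

/-- `⟨g, ν^k⟩`, the iterated integral of `g` against the signed measure `ν`. -/
noncomputable def pairing {E : Type*} [MeasurableSpace E] (ν : SignedMeasure E) :
    (k : ℕ) → ((Fin k → E) → ℝ) → ℝ
  | 0, g => g Fin.elim0
  | k + 1, g => ∫ᵛ x, pairing ν k (fun v => g (Fin.cons x v)) ∂<•ν

/-- The algebra `P` of polynomials on `M(E)`, as real-valued maps: the linear combinations of the
monomials `ν ↦ ⟨g, ν^k⟩`, `g ∈ Ĉ_Δ(E^k)`. -/
def MeasPoly (E : Type*) [TopologicalSpace E] [MeasurableSpace E] :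
    Submodule ℝ (SignedMeasure E → ℝ) :=
  Submodule.span ℝ {p | ∃ (k : ℕ) (g : C(Fin k → EDelta E, ℝ)), g ∈ SymCDelta E k ∧
    p = fun ν => pairing ν k fun v => g fun i => incl (v i)}

/-- `P^D = span {1, ⟨g, ν⟩^k : k ≥ 1, g ∈ D}`. -/
def MeasPolyD {E : Type*} [TopologicalSpace E] [MeasurableSpace E] (D : Submodule ℝ (CDelta E)) :
    Submodule ℝ (SignedMeasure E → ℝ) :=
  Submodule.span ℝ ({fun _ => (1 : ℝ)} ∪
    {p | ∃ (k : ℕ) (g : D), 1 ≤ k ∧ p = fun ν => (∫ᵛ x, (g : CDelta E) (incl x) ∂<•ν) ^ k})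

/-- `∂_x f(ν)`, the derivative of `f` at `ν` in the direction `δ_x`. -/
noncomputable def diracDeriv {E : Type*} [MeasurableSpace E] (x : E)
    (f : SignedMeasure E → ℝ) (ν : SignedMeasure E) : ℝ :=
  deriv (fun ε : ℝ => f (ν + ε • (Measure.dirac x).toSignedMeasure)) 0

/-- `L p(ν) = ⟨B(∂p(ν)), ν⟩ + ⟨Q(∂²p(ν)), ν²⟩ / 2` for all `p ∈ P^D` and `ν ∈ M_1(E)`. Here `b ∈ D`
is the function `∂p(ν)` and `q ∈ D ⊗ D` is the function `∂²p(ν)`. -/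
def HasForm {E : Type*} [TopologicalSpace E] [MeasurableSpace E] {D : Submodule ℝ (CDelta E)}
    (L : MeasPolyD D →ₗ[ℝ] MeasPoly E) (B : D →ₗ[ℝ] CDelta E)
    (Q : tensorSpace D →ₗ[ℝ] SymCDelta E 2) : Prop :=
  ∀ (p : MeasPolyD D) (μ : ProbabilityMeasure E),
    ∃ (b : D) (q : tensorSpace D),
      (∀ x : E, (b : CDelta E) (incl x) =
        diracDeriv x (p : SignedMeasure E → ℝ) (μ : Measure E).toSignedMeasure) ∧
      (∀ x y : E, (q : C(Fin 2 → EDelta E, ℝ)) ![incl x, incl y] =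
        diracDeriv x (diracDeriv y (p : SignedMeasure E → ℝ)) (μ : Measure E).toSignedMeasure) ∧
      (L p : SignedMeasure E → ℝ) (μ : Measure E).toSignedMeasure =
        (∫ x, B b (incl x) ∂(μ : Measure E)) +
          (1 / 2) * ∫ x, ∫ y, (Q q : C(Fin 2 → EDelta E, ℝ)) ![incl x, incl y]
            ∂(μ : Measure E) ∂(μ : Measure E)

/-! ### Positive maximum principle, conservativity, generators -/

/-- The positive maximum principle on `S ⊆ X` for an operator given by its graph
`G = {(f, 𝒜 f) : f in the domain}`. -/
def PositiveMaximumPrinciple {X : Type*} (S : Set X) (G : Set ((X → ℝ) × (X → ℝ))) : Prop :=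
  ∀ f h : X → ℝ, (f, h) ∈ G → ∀ x ∈ S, (∀ y ∈ S, f y ≤ f x) → 0 ≤ f x → h x ≤ 0

/-- `B` is `E`-conservative: there are `f_n ∈ D ∩ C_0(E)` with `f_n → 1` on `E` and
`(B f_n)⁻ → 0` on `E^Δ`, both in the bounded pointwise sense. -/
def IsConservative {E : Type*} [TopologicalSpace E] {D : Submodule ℝ (CDelta E)}
    (B : D →ₗ[ℝ] CDelta E) : Prop :=
  ∃ f : ℕ → D,
    (∀ n, Tendsto (fun x : E => (f n : CDelta E) (incl x)) (cocompact E) (𝓝 0)) ∧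
    (∃ C : ℝ, ∀ (n : ℕ) (x : E), |(f n : CDelta E) (incl x)| ≤ C) ∧
    (∀ x : E, Tendsto (fun n => (f n : CDelta E) (incl x)) atTop (𝓝 1)) ∧
    (∃ C : ℝ, ∀ (n : ℕ) (x : EDelta E), max (-(B (f n) x)) 0 ≤ C) ∧
    (∀ x : EDelta E, Tendsto (fun n => max (-(B (f n) x)) 0) atTop (𝓝 0))

/-- Strongly continuous groups of positive isometries of `C_Δ(E)`. -/
structure IsPositiveIsometryGroup {E : Type*} [TopologicalSpace E]
    (T : ℝ → CDelta E →L[ℝ] CDelta E) : Prop where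
  zero : T 0 = ContinuousLinearMap.id ℝ (CDelta E)
  add : ∀ s t, T (s + t) = (T s).comp (T t)
  strongly_continuous : ∀ g, Continuous fun t => T t g
  isometry : ∀ t g, ‖T t g‖ = ‖g‖
  positive : ∀ t g, 0 ≤ g → 0 ≤ T t g

/-- `A` is the generator of the group `T`: `g ∈ dom A` and `A g = h` iff
`(T_t g - g) / t → h` in norm as `t → 0`. -/
def IsGeneratorOf {E : Type*} [TopologicalSpace E] (A : CDelta E →ₗ.[ℝ] CDelta E)
    (T : ℝ → CDelta E →L[ℝ] CDelta E) : Prop :=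
  ∀ g h : CDelta E, (g, h) ∈ A.graph ↔
    Tendsto (fun t : ℝ => t⁻¹ • (T t g - g)) (𝓝[≠] 0) (𝓝 h)

/-- The restriction to `D` of an operator whose domain contains `D`. -/
def restrictTo {E : Type*} [TopologicalSpace E] {D : Submodule ℝ (CDelta E)}
    (A : CDelta E →ₗ.[ℝ] CDelta E) (h : D ≤ A.domain) : D →ₗ[ℝ] CDelta E :=
  A.toFun.comp (Submodule.inclusion h)

/-- The hypotheses of the existence theorem for probability-valued polynomial diffusions, for the
operator `L` on `P^D` given by `B` and by `Q = α Ψ + ∑ i, A_i ⊗ A_i`. -/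
structure ExistenceConditions {E : Type*} [TopologicalSpace E] [MeasurableSpace E]
    (D : Submodule ℝ (CDelta E)) (L : MeasPolyD D →ₗ[ℝ] MeasPoly E)
    (B : D →ₗ[ℝ] CDelta E) (Q : tensorSpace D →ₗ[ℝ] SymCDelta E 2)
    (α : E → E → ℝ) {n : ℕ} (A : Fin n → CDelta E →ₗ.[ℝ] CDelta E) : Prop where
  dense : Dense (D : Set (CDelta E))
  one_mem : (1 : CDelta E) ∈ D
  form : HasForm L B Q
  conservative : IsConservative B
  B_one : B ⟨1, one_mem⟩ = 0
  alpha_nonneg : ∀ x y, 0 ≤ α x y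
  alpha_symm : ∀ x y, α x y = α y x
  generator : ∀ i, ∃ T, IsPositiveIsometryGroup T ∧ IsGeneratorOf (A i) T
  domain : ∀ i, D ≤ (A i).domain
  domain_sq : ∀ (i : Fin n) (g : D), restrictTo (A i) (domain i) g ∈ (A i).domain
  Q_eq : ∀ (g : tensorSpace D) (x y : E),
    (Q g : C(Fin 2 → EDelta E, ℝ)) ![incl x, incl y] =
      α x y * Psi (fun u v => (g : C(Fin 2 → EDelta E, ℝ)) ![incl u, incl v]) x y +
        ∑ i, tensorOp (restrictTo (A i) (domain i)) g ![incl x, incl y]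
  maximum_principle : PositiveMaximumPrinciple (Set.univ : Set (EDelta E))
    {G | ∃ g : D, G = (fun x => (g : CDelta E) x,
      fun x => B g x - (1 / 2) *
        ∑ i, A i ⟨restrictTo (A i) (domain i) g, domain_sq i g⟩ x)}

end General

section Euclidean

/-- The functions in `ℝ + C_c^∞(ℝ^d)`. -/
def IsConstAddTest {d : ℕ} (F : EuclideanSpace ℝ (Fin d) → ℝ) : Prop :=
  ∃ (c : ℝ) (φ : EuclideanSpace ℝ (Fin d) → ℝ),
    ContDiff ℝ (⊤ : ℕ∞) φ ∧ HasCompactSupport φ ∧ F = fun x => c + φ x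

/-- `F` restricted to `E` is the element `g` of `C_Δ(E)`. -/
def Represents {d : ℕ} {E : Set (EuclideanSpace ℝ (Fin d))}
    (F : EuclideanSpace ℝ (Fin d) → ℝ) (g : CDelta E) : Prop :=
  ∀ x : E, g (incl x) = F x

/-- `D = {F|_E : F ∈ ℝ + C_c^∞(ℝ^d)}`. -/
def smoothDomain {d : ℕ} (E : Set (EuclideanSpace ℝ (Fin d))) : Submodule ℝ (CDelta E) where
  carrier := {g | ∃ F, IsConstAddTest F ∧ Represents F g}
  add_mem' := by
    rintro g h ⟨F, ⟨c, φ, hφ, hφc, rfl⟩, hF⟩ ⟨G, ⟨c', ψ, hψ, hψc, rfl⟩, hG⟩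
    refine ⟨_, ⟨c + c', φ + ψ, hφ.add hψ, hφc.add hψc, rfl⟩, fun x => ?_⟩
    have h1 := hF x
    have h2 := hG x
    simp only [ContinuousMap.add_apply, Pi.add_apply] at h1 h2 ⊢
    rw [h1, h2]
    ring
  zero_mem' := ⟨_, ⟨0, fun _ => 0, contDiff_const, HasCompactSupport.zero, rfl⟩, fun x => by simp⟩
  smul_mem' := by
    rintro a g ⟨F, ⟨c, φ, hφ, hφc, rfl⟩, hF⟩
    refine ⟨_, ⟨a * c, fun x => a * φ x, contDiff_const.mul hφ, hφc.mul_left, rfl⟩, fun x => ?_⟩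
    have h1 := hF x
    simp only [ContinuousMap.smul_apply, smul_eq_mul] at h1 ⊢
    rw [h1]
    ring

theorem one_mem_smoothDomain {d : ℕ} (E : Set (EuclideanSpace ℝ (Fin d))) :
    (1 : CDelta E) ∈ smoothDomain E :=
  ⟨_, ⟨1, fun _ => 0, contDiff_const, HasCompactSupport.zero, rfl⟩, fun x => by simp⟩

/-- `(τ^⊤ ∇F)(x)`. -/
noncomputable def tauGrad {d : ℕ} (τ : EuclideanSpace ℝ (Fin d) → Matrix (Fin d) (Fin d) ℝ)
    (F : EuclideanSpace ℝ (Fin d) → ℝ) (x : EuclideanSpace ℝ (Fin d)) : Fin d → ℝ :=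
  Matrix.mulVec (τ x).transpose (WithLp.ofLp (gradient F x))

/-- `τ_i^⊤ ∇F`, where `τ_i` is the `i`-th column of `τ`. -/
noncomputable def colDeriv {d : ℕ} (τ : EuclideanSpace ℝ (Fin d) → Matrix (Fin d) (Fin d) ℝ)
    (i : Fin d) (F : EuclideanSpace ℝ (Fin d) → ℝ) : EuclideanSpace ℝ (Fin d) → ℝ :=
  fun x => tauGrad τ F x i

/-- `Σ^d(E)`: the matrix fields on `ℝ^d` with components in `C_Δ(ℝ^d) ∩ C^1(ℝ^d)` such that
`τ(x)^⊤ ∇F(x) = 0` whenever `F ∈ ℝ + C_c^∞(ℝ^d)`, `x ∈ E` and `F(x) = max_E F`. -/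
def SigmaTangent {d : ℕ} (E : Set (EuclideanSpace ℝ (Fin d))) :
    Set (EuclideanSpace ℝ (Fin d) → Matrix (Fin d) (Fin d) ℝ) :=
  {τ | (∀ i j, ContDiff ℝ 1 fun x => τ x i j) ∧
    (∀ i j, ∃ f : CDelta (EuclideanSpace ℝ (Fin d)), ∀ x, f (incl x) = τ x i j) ∧
    ∀ F, IsConstAddTest F → ∀ x ∈ E, (∀ y ∈ E, F y ≤ F x) → tauGrad τ F x = 0}

end Euclidean

end MeasureValued

/-! Each column `τ_i` is a bounded `C^1` vector field on `ℝ^d`, so it has a global flow. Testing the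
condition in `Σ^d(E)` with functions that near `y` equal `R² - |u - z|²`, where `y` is a point of
`E` nearest to `z`, shows that `τ_i(y)` is orthogonal to every proximal normal `z - y`. A Grönwall
estimate for the squared distance to `E` then makes `E` invariant under the flow in both time
directions (`IsFlow.mem`). The flow thus acts on `E`, and on `E^Δ`, by homeomorphisms, and
composition with it is a group of positive isometries; `A_i` is its generator.

Difference quotients along the flow converge uniformly for every `C^1` function whose derivative has
compact support (`tendsto_flow_difference_quotient`). This class contains the test functions `F` and
also `τ_i^⊤ ∇F`, which is only `C^1`; hence `A_i(D)` lies in the domain and `A_i²` acts as `(τ_i^⊤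
∇)²`.

For the maximum principle, let `F` attain its maximum over `E` at `x`. Along the flow line through
`x`, which stays in `E`, time `0` is a maximum, so `(τ_i^⊤ ∇)² F(x) ≤ 0`. Since `c ≥ 1/2`, replacing
`c` by `1/2` adds a nonpositive term at `x`. If the maximum is attained at infinity, `F` equals its
maximum off a compact set, and the inequality passes to the limit. -/

namespace MeasureValued

/-! ### Global flows of bounded `C^1` fields and invariant closed sets -/

section Flow

variable {V : Type*} [NormedAddCommGroup V] [InnerProductSpace ℝ V]
  {v : V → V} {M : ℝ}

theorem dist_le_of_integralCurve {γ : ℝ → V} {s : Set ℝ} (hs : Convex ℝ s)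
    (hM : ∀ x, ‖v x‖ ≤ M) (hγ : ∀ t ∈ s, HasDerivAt γ (v (γ t)) t) {t₁ t₂ : ℝ}
    (h₁ : t₁ ∈ s) (h₂ : t₂ ∈ s) : dist (γ t₂) (γ t₁) ≤ M * |t₂ - t₁| := by
  have := hs.norm_image_sub_le_of_norm_hasDerivWithin_le (f := γ) (f' := fun t => v (γ t)) (C := M)
    (fun t ht => (hγ t ht).hasDerivWithinAt) (fun t _ => hM _) h₁ h₂
  rwa [dist_eq_norm, ← Real.norm_eq_abs]

/-- `φ` is the global flow of the vector field `v`. -/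
structure IsFlow (v : V → V) (φ : ℝ → V → V) : Prop where
  zero : ∀ x, φ 0 x = x
  deriv : ∀ x t, HasDerivAt (fun s => φ s x) (v (φ t x)) t

theorem IsFlow.reverse {φ : ℝ → V → V} (h : IsFlow v φ) : IsFlow (fun x => -v x) (fun t => φ (-t)) where
  zero x := by simpa using h.zero x
  deriv x t := by
    simpa [Function.comp_def] using (h.deriv x (-t)).scomp t (hasDerivAt_neg t)

theorem IsFlow.dist_le {φ : ℝ → V → V} (h : IsFlow v φ) (hM : ∀ x, ‖v x‖ ≤ M) (x : V) (s t : ℝ) :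
    dist (φ s x) (φ t x) ≤ M * |s - t| :=
  dist_le_of_integralCurve convex_univ hM (fun t _ => h.deriv x t) trivial trivial

variable [FiniteDimensional ℝ V]

theorem exists_lipschitzOnWith_closedBall (hv : ContDiff ℝ 1 v) (x : V) (R : ℝ) :
    ∃ K, LipschitzOnWith K v (Metric.closedBall x R) :=
  (hv.locallyLipschitz.locallyLipschitzOn).exists_lipschitzOnWith_of_compact
    (isCompact_closedBall x R)

/-- The field is only locally Lipschitz, but speed at most `M` confines both curves to one compact
ball, where a single Lipschitz constant serves. -/
theorem integralCurve_eqOn (hv : ContDiff ℝ 1 v) (hM : ∀ x, ‖v x‖ ≤ M) {a : ℝ} (ha : 0 < a)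
    {γ γ' : ℝ → V} (hγ : ∀ t ∈ Set.Ioo (-a) a, HasDerivAt γ (v (γ t)) t)
    (hγ' : ∀ t ∈ Set.Ioo (-a) a, HasDerivAt γ' (v (γ' t)) t) (h0 : γ 0 = γ' 0) :
    Set.EqOn γ γ' (Set.Ioo (-a) a) := by
  obtain ⟨K, hK⟩ := exists_lipschitzOnWith_closedBall hv (γ 0) (M * a)
  have hz : (0 : ℝ) ∈ Set.Ioo (-a) a := ⟨by linarith, ha⟩
  have hM0 : 0 ≤ M := (norm_nonneg _).trans (hM 0)
  have key : ∀ η : ℝ → V, (∀ t ∈ Set.Ioo (-a) a, HasDerivAt η (v (η t)) t) →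
      ∀ t ∈ Set.Ioo (-a) a, η t ∈ Metric.closedBall (η 0) (M * a) := by
    intro η hη t ht
    refine (dist_le_of_integralCurve (convex_Ioo _ _) hM hη hz ht).trans ?_
    rw [sub_zero]
    exact mul_le_mul_of_nonneg_left (abs_lt.mpr ht).le hM0
  exact ODE_solution_unique_of_mem_Ioo (v := fun _ => v)
    (s := fun _ => Metric.closedBall (γ 0) (M * a)) (fun _ _ => hK) hz
    (fun t ht => ⟨hγ t ht, key γ hγ t ht⟩) (fun t ht => ⟨hγ' t ht, h0 ▸ key γ' hγ' t ht⟩) h0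

theorem exists_integralCurve_Ioo (hv : ContDiff ℝ 1 v) (hM : ∀ x, ‖v x‖ ≤ M) (x : V) {a : ℝ}
    (ha : 0 < a) : ∃ γ : ℝ → V, γ 0 = x ∧ ∀ t ∈ Set.Ioo (-a) a, HasDerivAt γ (v (γ t)) t := by
  have hM0 : 0 ≤ M := (norm_nonneg _).trans (hM 0)
  obtain ⟨K, hK⟩ := exists_lipschitzOnWith_closedBall hv x (M * a)
  -- As `M` bounds `v` everywhere, the ball may have radius `M * a`, exactly what a curve can
  -- travel; the time interval need not be small.
  have hpl : IsPicardLindelof (fun _ => v) (tmin := -a) (tmax := a) ⟨0, by linarith, ha.le⟩ x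
      (Real.toNNReal (M * a)) 0 (Real.toNNReal M) K := by
    apply IsPicardLindelof.of_time_independent
    · intro y _
      rw [Real.coe_toNNReal _ hM0]
      exact hM y
    · rwa [Real.coe_toNNReal _ (by positivity)]
    · rw [Real.coe_toNNReal _ hM0, Real.coe_toNNReal _ (by positivity)]
      simp
  obtain ⟨γ, h0, hγ⟩ := hpl.exists_eq_forall_mem_Icc_hasDerivWithinAt₀
  exact ⟨γ, h0, fun t ht => (hγ t (Set.Ioo_subset_Icc_self ht)).hasDerivAt
    (Icc_mem_nhds ht.1 ht.2)⟩

theorem exists_integralCurve (hv : ContDiff ℝ 1 v) (hM : ∀ x, ‖v x‖ ≤ M) (x : V) :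
    ∃ γ : ℝ → V, γ 0 = x ∧ ∀ t, HasDerivAt γ (v (γ t)) t := by
  have h : ∀ a : ℝ, ∃ γ : ℝ → V, γ 0 = x ∧
      (0 < a → ∀ t ∈ Set.Ioo (-a) a, HasDerivAt γ (v (γ t)) t) := by
    intro a
    rcases lt_or_ge 0 a with ha | ha
    · obtain ⟨γ, h0, hγ⟩ := exists_integralCurve_Ioo hv hM x ha
      exact ⟨γ, h0, fun _ => hγ⟩
    · exact ⟨fun _ => x, rfl, fun h => absurd h ha.not_gt⟩
  choose γ h0 hγ using h
  have heq : ∀ a b : ℝ, 0 < a → a ≤ b → Set.EqOn (γ a) (γ b) (Set.Ioo (-a) a) := by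
    intro a b ha hab
    exact integralCurve_eqOn hv hM ha (hγ a ha) (fun t ht => hγ b (ha.trans_le hab) t
      ⟨by linarith [ht.1], by linarith [ht.2]⟩) (by rw [h0, h0])
  -- At time `t` the solution on `(-(|t| + 1), |t| + 1)` is used; for times near `t` all these
  -- choices agree with the single curve `γ (|t| + 2)`, which gives the derivative.
  refine ⟨fun t => γ (|t| + 1) t, h0 _, fun t => ?_⟩
  have hb : 0 < |t| + 2 := by positivity
  have hev : (fun s => γ (|s| + 1) s) =ᶠ[𝓝 t] γ (|t| + 2) := by
    have : ∀ᶠ s in 𝓝 t, |s| < |t| + 1 := continuous_abs.continuousAt.eventually_lt_const (by linarith)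
    filter_upwards [this] with s hs
    exact heq _ _ (by positivity) (by linarith) (abs_lt.mp (by linarith))
  have := (hγ _ hb t (abs_lt.mp (by linarith))).congr_of_eventuallyEq hev
  rwa [← hev.eq_of_nhds] at this

theorem exists_isFlow (hv : ContDiff ℝ 1 v) (hM : ∀ x, ‖v x‖ ≤ M) : ∃ φ, IsFlow v φ := by
  choose γ h0 hγ using exists_integralCurve hv hM
  exact ⟨fun t x => γ x t, h0, hγ⟩

namespace IsFlow

variable {φ : ℝ → V → V}

theorem eq_of_integralCurve (h : IsFlow v φ) (hv : ContDiff ℝ 1 v) (hM : ∀ x, ‖v x‖ ≤ M)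
    {γ : ℝ → V} (hγ : ∀ t, HasDerivAt γ (v (γ t)) t) (t : ℝ) : γ t = φ t (γ 0) :=
  integralCurve_eqOn hv hM (a := |t| + 1) (by positivity) (fun s _ => hγ s)
    (fun s _ => h.deriv _ s) (h.zero _).symm (abs_lt.mp (by linarith))

theorem add (h : IsFlow v φ) (hv : ContDiff ℝ 1 v) (hM : ∀ x, ‖v x‖ ≤ M) (s t : ℝ) (x : V) :
    φ (s + t) x = φ s (φ t x) := by
  have := h.eq_of_integralCurve hv hM (γ := fun s => φ (s + t) x)
    (fun s => (h.deriv x (s + t)).comp_add_const s t) s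
  simpa using this

/-- Trajectories started within distance `1` of `x` stay up to time `t` in a ball of radius `1 + M *
t`, so Grönwall applies with the Lipschitz constant of that ball. -/
theorem continuous_of_nonneg (h : IsFlow v φ) (hv : ContDiff ℝ 1 v) (hM : ∀ x, ‖v x‖ ≤ M)
    {t : ℝ} (ht : 0 ≤ t) : Continuous (φ t) := by
  have hM0 : 0 ≤ M := (norm_nonneg _).trans (hM 0)
  rw [continuous_iff_continuousAt]
  intro x
  obtain ⟨K, hK⟩ := exists_lipschitzOnWith_closedBall hv x (1 + M * t)
  have hball : ∀ y ∈ Metric.closedBall x 1, ∀ s ∈ Set.Ico 0 t,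
      φ s y ∈ Metric.closedBall x (1 + M * t) := by
    intro y hy s hs
    have h1 := h.dist_le hM y s 0
    rw [h.zero, sub_zero, abs_of_nonneg hs.1] at h1
    have h2 : M * s ≤ M * t := mul_le_mul_of_nonneg_left hs.2.le hM0
    have h3 := dist_triangle (φ s y) y x
    rw [Metric.mem_closedBall] at hy ⊢
    linarith
  have hc : ∀ y, ContinuousOn (fun s => φ s y) (Set.Icc 0 t) := fun y s _ =>
    (h.deriv y s).continuousAt.continuousWithinAt
  have hle : ∀ y ∈ Metric.closedBall x 1, dist (φ t y) (φ t x) ≤ dist y x * Real.exp (K * (t - 0)) :=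
    fun y hy => dist_le_of_trajectories_ODE_of_mem (v := fun _ => v)
      (s := fun _ => Metric.closedBall x (1 + M * t)) (fun _ _ => hK)
      (hc y) (fun s _ => (h.deriv y s).hasDerivWithinAt) (hball y hy)
      (hc x) (fun s _ => (h.deriv x s).hasDerivWithinAt)
      (hball x (Metric.mem_closedBall_self zero_le_one)) (by simp [h.zero]) t ⟨ht, le_rfl⟩
  have hlim : Tendsto (fun y => dist y x * Real.exp (K * (t - 0))) (𝓝 x) (𝓝 0) := by
    have : Continuous fun y => dist y x * Real.exp (K * (t - 0)) := by fun_prop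
    simpa using this.tendsto x
  refine tendsto_iff_dist_tendsto_zero.mpr (squeeze_zero' (Eventually.of_forall fun _ => dist_nonneg)
    ?_ hlim)
  filter_upwards [Metric.closedBall_mem_nhds x one_pos] with y hy using hle y hy

theorem continuous (h : IsFlow v φ) (hv : ContDiff ℝ 1 v) (hM : ∀ x, ‖v x‖ ≤ M) (t : ℝ) :
    Continuous (φ t) := by
  rcases le_total 0 t with ht | ht
  · exact h.continuous_of_nonneg hv hM ht
  · simpa using h.reverse.continuous_of_nonneg hv.neg (M := M) (by simpa using hM)
      (neg_nonneg.mpr ht)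

/-- Nagumo's invariance theorem: a flow whose field is orthogonal to all proximal normals of a
closed set leaves this set invariant. -/
theorem mem_of_nonneg (h : IsFlow v φ) (hv : ContDiff ℝ 1 v) (hM : ∀ x, ‖v x‖ ≤ M) {E : Set V}
    (hE : IsClosed E)
    (htan : ∀ y ∈ E, ∀ z, (∀ u ∈ E, dist z y ≤ dist z u) → inner ℝ (v y) (z - y) = 0)
    {x : V} (hx : x ∈ E) {t : ℝ} (ht : 0 ≤ t) : φ t x ∈ E := by
  have hM0 : 0 ≤ M := (norm_nonneg _).trans (hM 0)
  -- The trajectory stays within `M * t` of `x`, and its nearest point in `E` is no farther from it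
  -- than `x` is: hence the factor `2`.
  obtain ⟨K, hK⟩ := exists_lipschitzOnWith_closedBall hv x (2 * (M * t))
  set f : ℝ → ℝ := fun s => Metric.infDist (φ s x) E ^ 2 with hf
  have hfc : ContinuousOn f (Set.Icc 0 t) := fun s _ =>
    (((Metric.continuous_infDist_pt E).continuousAt.comp (h.deriv x s).continuousAt).pow
      2).continuousWithinAt
  have hproj : ∀ s, ∃ y ∈ E, Metric.infDist (φ s x) E = dist (φ s x) y := fun s =>
    hE.exists_infDist_eq_dist ⟨x, hx⟩ _
  choose p hpE hp using hproj
  -- Tangency allows `v (p s)` to be subtracted inside the inner product; the Lipschitz bound then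
  -- yields the squared distance.
  have hbound : ∀ s ∈ Set.Ico 0 t, 2 * inner ℝ (φ s x - p s) (v (φ s x)) ≤ 2 * K * f s + 0 := by
    intro s hs
    have hmin : ∀ u ∈ E, dist (φ s x) (p s) ≤ dist (φ s x) u := fun u hu => by
      rw [← hp]; exact Metric.infDist_le_dist_of_mem hu
    have hz := htan (p s) (hpE s) (φ s x) hmin
    have h1 := h.dist_le hM x s 0
    rw [h.zero, sub_zero, abs_of_nonneg hs.1] at h1
    have h2 : M * s ≤ M * t := mul_le_mul_of_nonneg_left hs.2.le hM0
    have h3 := hmin x hx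
    have h4 := dist_triangle (p s) (φ s x) x
    rw [dist_comm (p s) (φ s x)] at h4
    have h5 : 0 ≤ M * t := mul_nonneg hM0 ht
    have hlip := hK.dist_le_mul (φ s x) (by rw [Metric.mem_closedBall]; linarith) (p s)
      (by rw [Metric.mem_closedBall]; linarith)
    rw [real_inner_comm] at hz
    have h6 : inner ℝ (φ s x - p s) (v (φ s x)) =
        inner ℝ (φ s x - p s) (v (φ s x) - v (p s)) := by
      rw [inner_sub_right, hz, sub_zero]
    have h7 := real_inner_le_norm (φ s x - p s) (v (φ s x) - v (p s))
    rw [← dist_eq_norm, ← dist_eq_norm] at h7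
    have h8 : dist (φ s x) (p s) * dist (v (φ s x)) (v (p s)) ≤
        dist (φ s x) (p s) * (K * dist (φ s x) (p s)) :=
      mul_le_mul_of_nonneg_left hlip dist_nonneg
    simp only [hf, hp]
    rw [h6]
    nlinarith
  -- The distance to `E` need not be differentiable. Freezing the projection `p s` gives a smooth
  -- majorant of `f` that touches it at time `s`, which bounds the right-hand quotients.
  have hslope : ∀ s ∈ Set.Ico 0 t, ∀ r, 2 * inner ℝ (φ s x - p s) (v (φ s x)) < r →
      ∃ᶠ z in 𝓝[>] s, (z - s)⁻¹ * (f z - f s) < r := by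
    intro s _ r hr
    have hd : HasDerivAt (fun z => ‖φ z x - p s‖ ^ 2) (2 * inner ℝ (φ s x - p s) (v (φ s x))) s :=
      ((h.deriv x s).sub_const (p s)).norm_sq
    have hlim := (hasDerivAt_iff_tendsto_slope.mp hd).mono_left
      (nhdsWithin_mono s (fun z (hz : s < z) => hz.ne'))
    refine Eventually.frequently ?_
    filter_upwards [hlim.eventually_lt_const hr, self_mem_nhdsWithin] with z hz hsz
    refine lt_of_le_of_lt ?_ hz
    rw [slope_def_field, div_eq_inv_mul]
    refine mul_le_mul_of_nonneg_left ?_ (inv_nonneg.mpr (sub_nonneg.mpr (le_of_lt hsz)))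
    have h1 : Metric.infDist (φ z x) E ≤ dist (φ z x) (p s) :=
      Metric.infDist_le_dist_of_mem (hpE s)
    have h2 : f z ≤ ‖φ z x - p s‖ ^ 2 := by
      rw [← dist_eq_norm]
      exact pow_le_pow_left₀ Metric.infDist_nonneg h1 2
    have h3 : f s = ‖φ s x - p s‖ ^ 2 := by rw [← dist_eq_norm, ← hp]
    linarith
  have hfin := le_gronwallBound_of_liminf_deriv_right_le hfc hslope (δ := 0)
    (by simp [hf, h.zero, Metric.infDist_zero_of_mem hx]) hbound t ⟨ht, le_rfl⟩
  rw [gronwallBound_ε0_δ0] at hfin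
  have h0 : Metric.infDist (φ t x) E = 0 :=
    pow_eq_zero_iff two_ne_zero |>.mp (le_antisymm hfin (sq_nonneg _))
  exact (hE.mem_iff_infDist_zero ⟨x, hx⟩).mpr h0

theorem mem (h : IsFlow v φ) (hv : ContDiff ℝ 1 v) (hM : ∀ x, ‖v x‖ ≤ M) {E : Set V}
    (hE : IsClosed E)
    (htan : ∀ y ∈ E, ∀ z, (∀ u ∈ E, dist z y ≤ dist z u) → inner ℝ (v y) (z - y) = 0)
    {x : V} (hx : x ∈ E) (t : ℝ) : φ t x ∈ E := by
  rcases le_total 0 t with ht | ht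
  · exact h.mem_of_nonneg hv hM hE htan hx ht
  -- Tangency is an equality, so the reversed field satisfies it too.
  · simpa using h.reverse.mem_of_nonneg hv.neg (M := M) (by simpa using hM) hE
      (fun y hy z hz => by rw [inner_neg_left, htan y hy z hz, neg_zero]) hx (neg_nonneg.mpr ht)

end IsFlow

end Flow

/-! ### Functions and homeomorphisms on `E^Δ` -/

section Compactification

variable {X : Type*} [TopologicalSpace X]

theorem continuous_incl : Continuous (incl : X → EDelta X) :=
  OnePoint.continuous_coe.subtype_mk _

theorem denseRange_incl : DenseRange (incl : X → EDelta X) := by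
  rw [DenseRange, dense_iff_closure_eq, Set.eq_univ_iff_forall]
  intro p
  rw [closure_subtype]
  have : (Subtype.val '' Set.range (incl : X → EDelta X)) =
      Set.range ((↑) : X → OnePoint X) := by
    rw [← Set.range_comp]
    rfl
  rw [this]
  exact p.2

theorem edelta_cases (p : EDelta X) : (∃ x, p = incl x) ∨ (p : OnePoint X) = OnePoint.infty := by
  obtain ⟨p, hp⟩ := p
  induction p using OnePoint.rec with
  | infty => exact Or.inr rfl
  | coe x => exact Or.inl ⟨x, rfl⟩

theorem CDelta.ext_incl {g h : CDelta X} (H : ∀ x, g (incl x) = h (incl x)) : g = h :=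
  ContinuousMap.coe_injective
    (denseRange_incl.equalizer g.continuous h.continuous (funext H))

theorem CDelta.norm_le_of_incl {g : CDelta X} {C : ℝ} (hC : 0 ≤ C) (H : ∀ x, |g (incl x)| ≤ C) :
    ‖g‖ ≤ C := by
  rw [ContinuousMap.norm_le _ hC]
  intro p
  exact denseRange_incl.induction_on (p := fun p => ‖g p‖ ≤ C) p
    (isClosed_le (by fun_prop) continuous_const) H

/-- The extension to `E^Δ` of a continuous map on `E` with a limit at infinity. -/
def extendFun (f : C(X, ℝ)) (a : ℝ) (h : Tendsto f (coclosedCompact X) (𝓝 a)) : CDelta X :=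
  (OnePoint.continuousMapMk f a h).comp ⟨Subtype.val, continuous_subtype_val⟩

theorem onePointCongr_mem_closure (f : X ≃ₜ X) (p : EDelta X) :
    f.onePointCongr p ∈ closure (Set.range ((↑) : X → OnePoint X)) := by
  have hm : Set.MapsTo f.onePointCongr (Set.range ((↑) : X → OnePoint X))
      (Set.range ((↑) : X → OnePoint X)) := by
    rintro _ ⟨x, rfl⟩
    exact ⟨f x, rfl⟩
  exact hm.closure f.onePointCongr.continuous p.2

/-- The extension of a homeomorphism of `E` to `E^Δ`. -/
def extendHomeo (f : X ≃ₜ X) : C(EDelta X, EDelta X) where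
  toFun p := ⟨f.onePointCongr p, onePointCongr_mem_closure f p⟩
  continuous_toFun := (f.onePointCongr.continuous.comp continuous_subtype_val).subtype_mk _

theorem extendHomeo_incl (f : X ≃ₜ X) (x : X) : extendHomeo f (incl x) = incl (f x) := rfl

variable [T2Space X] [WeaklyLocallyCompactSpace X]

/-- A point at infinity is a limit of points of `E` outside any given compact set. -/
theorem mem_of_eventually_mem {Y : Type*} [TopologicalSpace Y] {f : EDelta X → Y}
    (hf : Continuous f) {S : Set Y} (hS : IsClosed S) {K : Set X} (hK : IsCompact K)
    {p : EDelta X} (hp : ∀ x, p ≠ incl x) (H : ∀ x ∉ K, f (incl x) ∈ S) : f p ∈ S := by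
  by_contra hpS
  have hU : IsOpen (f ⁻¹' Sᶜ ∩ (incl '' K)ᶜ) :=
    (hS.isOpen_compl.preimage hf).inter (hK.image continuous_incl).isClosed.isOpen_compl
  obtain ⟨x, hx⟩ := denseRange_incl.exists_mem_open hU
    ⟨p, hpS, by rintro ⟨x, -, rfl⟩; exact hp x rfl⟩
  exact hx.1 (H x fun hxK => hx.2 ⟨x, hxK, rfl⟩)

end Compactification

/-! ### The domain `D` and its density -/

section Domain

variable {d : ℕ} {E : Set (EuclideanSpace ℝ (Fin d))}

theorem Represents.unique {F : EuclideanSpace ℝ (Fin d) → ℝ} {g h : CDelta E}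
    (hg : Represents F g) (hh : Represents F h) : g = h :=
  CDelta.ext_incl fun x => (hg x).trans (hh x).symm

theorem isCompact_preimage_val (hE : IsClosed E) {K : Set (EuclideanSpace ℝ (Fin d))}
    (hK : IsCompact K) : IsCompact ((↑) ⁻¹' K : Set E) :=
  hE.isClosedEmbedding_subtypeVal.isCompact_preimage hK

theorem exists_represents (hE : IsClosed E) {F : EuclideanSpace ℝ (Fin d) → ℝ} {c : ℝ}
    (hF : Continuous F) (hc : HasCompactSupport fun x => F x - c) :
    ∃ g : CDelta E, Represents F g := by
  have hlim : Tendsto (fun x : E => F x) (coclosedCompact E) (𝓝 c) := by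
    refine tendsto_const_nhds.congr' ?_
    rw [Filter.coclosedCompact_eq_cocompact]
    filter_upwards [(isCompact_preimage_val hE hc).compl_mem_cocompact] with x hx
    have : F x - c = 0 := image_eq_zero_of_notMem_tsupport (f := fun x => F x - c) hx
    linarith
  exact ⟨extendFun ⟨fun x : E => F x, by fun_prop⟩ c hlim, fun x => rfl⟩

theorem IsConstAddTest.contDiff {F : EuclideanSpace ℝ (Fin d) → ℝ} (hF : IsConstAddTest F) :
    ContDiff ℝ (⊤ : ℕ∞) F := by
  obtain ⟨c, φ, hφ, -, rfl⟩ := hF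
  exact contDiff_const.add hφ

theorem IsConstAddTest.exists_const {F : EuclideanSpace ℝ (Fin d) → ℝ} (hF : IsConstAddTest F) :
    ∃ c, HasCompactSupport fun x => F x - c := by
  obtain ⟨c, φ, -, hc, rfl⟩ := hF
  exact ⟨c, by simpa using hc⟩

theorem IsConstAddTest.mul {F G : EuclideanSpace ℝ (Fin d) → ℝ} (hF : IsConstAddTest F)
    (hG : IsConstAddTest G) : IsConstAddTest (F * G) := by
  obtain ⟨c, φ, hφ, hφc, rfl⟩ := hF
  obtain ⟨b, ψ, hψ, hψc, rfl⟩ := hG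
  refine ⟨c * b, fun x => c * ψ x + φ x * (b + ψ x), by fun_prop, ?_, ?_⟩
  · exact hψc.mul_left.add hφc.mul_right
  · ext x
    simp only [Pi.mul_apply]
    ring

theorem ContDiffBump.isConstAddTest {x : EuclideanSpace ℝ (Fin d)} (χ : ContDiffBump x) :
    IsConstAddTest χ :=
  ⟨0, χ, χ.contDiff, χ.hasCompactSupport, by simp⟩

/-- Stone–Weierstrass. Of two distinct points of `E^Δ` at least one lies in `E`, and a bump function
around it separates them. -/
theorem dense_smoothDomain (hE : IsClosed E) : Dense (smoothDomain E : Set (CDelta E)) := by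
  have : LocallyCompactSpace E := hE.isClosedEmbedding_subtypeVal.locallyCompactSpace
  let S : Subalgebra ℝ (CDelta E) :=
    { smoothDomain E with
      mul_mem' := by
        rintro g h ⟨F, hF, hFg⟩ ⟨G, hG, hGh⟩
        exact ⟨F * G, hF.mul hG, fun x => by simp [hFg x, hGh x]⟩
      one_mem' := one_mem_smoothDomain E
      algebraMap_mem' := fun r => by
        rw [Algebra.algebraMap_eq_smul_one]
        exact (smoothDomain E).smul_mem r (one_mem_smoothDomain E) }
  have key : ∀ (x : E) (q : EDelta E), incl x ≠ q → ∃ f ∈ S, f (incl x) ≠ f q := by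
    intro x q hq
    -- The outer radius of the bump: the distance to `q` if `q` lies in `E`. If `q` is at infinity
    -- any radius will do, as the bump has compact support.
    obtain ⟨r, hr, hy⟩ : ∃ r > 0, ∀ y : E, q = incl y → r ≤ dist (y : EuclideanSpace ℝ (Fin d)) x := by
      by_cases h : ∃ y : E, q = incl y
      · obtain ⟨y, rfl⟩ := h
        have hyx : y ≠ x := fun h => hq (h ▸ rfl)
        refine ⟨dist y x, dist_pos.mpr hyx, fun z hz => ?_⟩
        have : y = z := OnePoint.coe_injective (congrArg Subtype.val hz)
        rw [this]
        exact le_rfl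
      · exact ⟨1, one_pos, fun y hy => absurd ⟨y, hy⟩ h⟩
    let χ : ContDiffBump (x : EuclideanSpace ℝ (Fin d)) := ⟨r / 2, r, by positivity, by linarith⟩
    obtain ⟨g, hg⟩ := exists_represents hE (c := 0) χ.continuous (by simpa using χ.hasCompactSupport)
    refine ⟨g, ⟨χ, ContDiffBump.isConstAddTest χ, hg⟩, ?_⟩
    have h1 : g (incl x) = 1 := by
      rw [hg x]
      exact χ.one_of_mem_closedBall (Metric.mem_closedBall_self (by positivity))
    have h2 : g q = 0 := by
      by_cases h : ∃ y : E, q = incl y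
      · obtain ⟨y, rfl⟩ := h
        rw [hg y]
        exact χ.zero_of_le_dist (hy y rfl)
      · push Not at h
        exact mem_of_eventually_mem g.continuous isClosed_singleton
          (isCompact_preimage_val hE χ.hasCompactSupport) h fun y hy' => by
            rw [Set.mem_singleton_iff, hg y]
            exact image_eq_zero_of_notMem_tsupport hy'
    rw [h1, h2]
    exact one_ne_zero
  have hsep : S.SeparatesPoints := by
    intro p q hpq
    rcases edelta_cases p with ⟨x, rfl⟩ | hp
    · obtain ⟨f, hf, hne⟩ := key x q hpq
      exact ⟨f, ⟨f, hf, rfl⟩, hne⟩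
    · rcases edelta_cases q with ⟨x, rfl⟩ | hq
      · obtain ⟨f, hf, hne⟩ := key x p hpq.symm
        exact ⟨f, ⟨f, hf, rfl⟩, hne.symm⟩
      · exact absurd (Subtype.ext (hp.trans hq.symm)) hpq
  have := ContinuousMap.subalgebra_topologicalClosure_eq_top_of_separatesPoints S hsep
  rw [dense_iff_closure_eq]
  exact congrArg (fun T : Subalgebra ℝ (CDelta E) => (T : Set (CDelta E))) this

end Domain

/-! ### Composition groups and their generators -/

section Group

variable {X : Type*} [TopologicalSpace X]

/-- Composition with a continuous map of `E^Δ`, as a bounded operator on `C_Δ(E)`. -/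
noncomputable def compOperator (ψ : C(EDelta X, EDelta X)) : CDelta X →L[ℝ] CDelta X :=
  LinearMap.mkContinuous
    { toFun := fun g => g.comp ψ
      map_add' := fun _ _ => rfl
      map_smul' := fun _ _ => rfl } 1 fun g => by
    rw [one_mul, ContinuousMap.norm_le _ (norm_nonneg _)]
    exact fun p => g.norm_coe_le_norm _

theorem compOperator_apply (ψ : C(EDelta X, EDelta X)) (g : CDelta X) (p : EDelta X) :
    compOperator ψ g p = g (ψ p) := rfl

theorem norm_compOperator_le (ψ : C(EDelta X, EDelta X)) (g : CDelta X) :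
    ‖compOperator ψ g‖ ≤ ‖g‖ := by
  rw [ContinuousMap.norm_le _ (norm_nonneg _)]
  exact fun p => g.norm_coe_le_norm _

/-- Composition operators are contractions. Hence strong continuity on a dense set suffices, by
uniform approximation, and a contraction whose inverse is also a contraction is an isometry. -/
theorem isPositiveIsometryGroup_compOperator {Φ : ℝ → X ≃ₜ X} (h0 : ∀ x, Φ 0 x = x)
    (hadd : ∀ s t x, Φ (s + t) x = Φ s (Φ t x)) {D : Set (CDelta X)} (hD : Dense D)
    (hcont : ∀ g ∈ D, Continuous fun t => compOperator (extendHomeo (Φ t)) g) :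
    IsPositiveIsometryGroup fun t => compOperator (extendHomeo (Φ t)) := by
  have hz : compOperator (extendHomeo (Φ 0)) = ContinuousLinearMap.id ℝ (CDelta X) := by
    refine ContinuousLinearMap.ext fun g => CDelta.ext_incl fun x => ?_
    rw [compOperator_apply, extendHomeo_incl, h0]
    rfl
  have ha : ∀ s t, compOperator (extendHomeo (Φ (s + t))) =
      (compOperator (extendHomeo (Φ s))).comp (compOperator (extendHomeo (Φ t))) := by
    refine fun s t => ContinuousLinearMap.ext fun g => CDelta.ext_incl fun x => ?_
    -- Composition reverses the order of the maps; commutativity of time addition repairs it.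
    rw [ContinuousLinearMap.comp_apply, compOperator_apply, compOperator_apply, compOperator_apply,
      extendHomeo_incl, extendHomeo_incl, extendHomeo_incl, add_comm, hadd]
  refine ⟨hz, ha, fun g => ?_, fun t g => ?_, fun t g hg p => hg (extendHomeo (Φ t) p)⟩
  · refine continuous_of_uniform_approx_of_continuous fun u hu => ?_
    obtain ⟨ε, hε, hεu⟩ := Metric.mem_uniformity_dist.mp hu
    obtain ⟨f, hfD, hf⟩ := hD.exists_dist_lt g hε
    refine ⟨_, hcont f hfD, fun t => hεu ?_⟩
    rw [dist_eq_norm, ← map_sub]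
    exact (norm_compOperator_le _ _).trans_lt (by rwa [← dist_eq_norm])
  · refine le_antisymm (norm_compOperator_le _ _) ?_
    have h := norm_compOperator_le (extendHomeo (Φ (-t))) (compOperator (extendHomeo (Φ t)) g)
    rwa [← ContinuousLinearMap.comp_apply, ← ha, neg_add_cancel, hz] at h

/-- The limit relation is itself a linear subspace, and uniqueness of limits makes it single-valued,
so it is the graph of an operator; the group law plays no role. -/
theorem exists_isGeneratorOf (T : ℝ → CDelta X →L[ℝ] CDelta X) : ∃ A, IsGeneratorOf A T := by
  let S : Submodule ℝ (CDelta X × CDelta X) :=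
    { carrier := {p | Tendsto (fun t : ℝ => t⁻¹ • (T t p.1 - p.1)) (𝓝[≠] 0) (𝓝 p.2)}
      zero_mem' := by simp
      add_mem' := by
        intro p q hp hq
        refine (Tendsto.add hp hq).congr fun t => ?_
        rw [← smul_add, Prod.fst_add, map_add, add_sub_add_comm]
      smul_mem' := by
        intro c p hp
        refine (Tendsto.const_smul hp c).congr fun t => ?_
        rw [smul_comm, smul_sub, Prod.smul_fst, map_smul] }
  have hS : ∀ p ∈ S, p.1 = 0 → p.2 = 0 := by
    intro p hp hp0
    have h : Tendsto (fun t : ℝ => t⁻¹ • (T t p.1 - p.1)) (𝓝[≠] 0) (𝓝 p.2) := hp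
    simp only [hp0, map_zero, sub_zero, smul_zero] at h
    exact tendsto_nhds_unique h tendsto_const_nhds
  refine ⟨S.toLinearPMap, fun g h => ?_⟩
  rw [Submodule.toLinearPMap_graph_eq S hS]
  rfl

end Group

/-! ### The group generated by a tangent vector field -/

section Tangent

variable {d : ℕ} {E : Set (EuclideanSpace ℝ (Fin d))}
  {v : EuclideanSpace ℝ (Fin d) → EuclideanSpace ℝ (Fin d)} {M : ℝ}
  {φ : ℝ → EuclideanSpace ℝ (Fin d) → EuclideanSpace ℝ (Fin d)}

/-- The homeomorphisms of an invariant set given by a flow. -/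
def flowHomeo (h : IsFlow v φ) (hv : ContDiff ℝ 1 v) (hM : ∀ x, ‖v x‖ ≤ M)
    (hinv : ∀ x ∈ E, ∀ t, φ t x ∈ E) (t : ℝ) : E ≃ₜ E where
  toFun x := ⟨φ t x, hinv x x.2 t⟩
  invFun x := ⟨φ (-t) x, hinv x x.2 (-t)⟩
  left_inv x := Subtype.ext <| by
    change φ (-t) (φ t x) = x
    rw [← h.add hv hM, neg_add_cancel, h.zero]
  right_inv x := Subtype.ext <| by
    change φ t (φ (-t) x) = x
    rw [← h.add hv hM, add_neg_cancel, h.zero]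
  continuous_toFun := ((h.continuous hv hM t).comp continuous_subtype_val).subtype_mk _
  continuous_invFun := ((h.continuous hv hM (-t)).comp continuous_subtype_val).subtype_mk _

theorem IsConstAddTest.lipschitzWith {F : EuclideanSpace ℝ (Fin d) → ℝ} (hF : IsConstAddTest F) :
    ∃ C, LipschitzWith C F := by
  obtain ⟨c, φ, hφ, hc, rfl⟩ := hF
  obtain ⟨C, hC⟩ := ContDiff.lipschitzWith_of_hasCompactSupport hc hφ (by simp)
  exact ⟨C, LipschitzWith.of_dist_le_mul fun x y => by simpa using hC.dist_le_mul x y⟩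

theorem continuous_flow_smoothDomain (h : IsFlow v φ) (hv : ContDiff ℝ 1 v) (hM : ∀ x, ‖v x‖ ≤ M)
    (hinv : ∀ x ∈ E, ∀ t, φ t x ∈ E) {g : CDelta E} (hg : g ∈ smoothDomain E) :
    Continuous fun t => compOperator (extendHomeo (flowHomeo h hv hM hinv t)) g := by
  obtain ⟨F, hF, hFg⟩ := hg
  obtain ⟨C, hC⟩ := hF.lipschitzWith
  have hM0 : 0 ≤ M := (norm_nonneg _).trans (hM 0)
  refine (LipschitzWith.of_dist_le_mul (K := C * M.toNNReal) fun s t => ?_).continuous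
  rw [NNReal.coe_mul, Real.coe_toNNReal _ hM0, dist_eq_norm]
  refine CDelta.norm_le_of_incl (by positivity) fun x => ?_
  rw [ContinuousMap.sub_apply, compOperator_apply, compOperator_apply, extendHomeo_incl,
    extendHomeo_incl, hFg, hFg, ← Real.dist_eq, mul_assoc]
  exact (hC.dist_le_mul _ _).trans (mul_le_mul_of_nonneg_left (h.dist_le hM x s t) C.2)

theorem hasDerivAt_comp_flow (h : IsFlow v φ) {F : EuclideanSpace ℝ (Fin d) → ℝ}
    (hF : Differentiable ℝ F) (x : EuclideanSpace ℝ (Fin d)) (t : ℝ) :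
    HasDerivAt (fun s => F (φ s x)) (fderiv ℝ F (φ t x) (v (φ t x))) t :=
  (hF _).hasFDerivAt.comp_hasDerivAt t (h.deriv x t)

theorem continuous_lieDeriv (hv : Continuous v) {F : EuclideanSpace ℝ (Fin d) → ℝ}
    (hF : ContDiff ℝ 1 F) : Continuous fun x => fderiv ℝ F x (v x) :=
  (hF.continuous_fderiv (by simp)).clm_apply hv

theorem hasCompactSupport_lieDeriv {F : EuclideanSpace ℝ (Fin d) → ℝ}
    (hF : HasCompactSupport (fderiv ℝ F)) : HasCompactSupport fun x => fderiv ℝ F x (v x) :=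
  hF.mono fun x hx hx0 => hx (by simp [hx0])

/-- The Lie derivative `k` is continuous with compact support, hence uniformly continuous; bounded
speed makes `k (φ s x) - k x` small uniformly in `x`. Only `C^1` is asked of `F`, so that the result
also applies to a Lie derivative. -/
theorem tendsto_flow_difference_quotient (h : IsFlow v φ) (hv : ContDiff ℝ 1 v)
    (hM : ∀ x, ‖v x‖ ≤ M) (hinv : ∀ x ∈ E, ∀ t, φ t x ∈ E)
    {F : EuclideanSpace ℝ (Fin d) → ℝ} (hF : ContDiff ℝ 1 F)
    (hFc : HasCompactSupport (fderiv ℝ F)) {g G : CDelta E} (hg : Represents F g)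
    (hG : Represents (fun x => fderiv ℝ F x (v x)) G) :
    Tendsto (fun t : ℝ => t⁻¹ • (compOperator (extendHomeo (flowHomeo h hv hM hinv t)) g - g))
      (𝓝[≠] 0) (𝓝 G) := by
  have hM0 : 0 ≤ M := (norm_nonneg _).trans (hM 0)
  set k := fun x => fderiv ℝ F x (v x) with hk
  have huc : UniformContinuous k := (hasCompactSupport_lieDeriv hFc).uniformContinuous_of_continuous
    (continuous_lieDeriv hv.continuous hF)
  rw [Metric.tendsto_nhdsWithin_nhds]
  intro ε hε
  obtain ⟨δ, hδ, hδk⟩ := Metric.uniformContinuous_iff.mp huc (ε / 2) (by positivity)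
  -- `M + 1` rather than `M`, since `M` may be `0`.
  refine ⟨δ / (M + 1), by positivity, fun t ht0 ht => ?_⟩
  rw [dist_zero_right, Real.norm_eq_abs, lt_div_iff₀ (by positivity)] at ht
  refine lt_of_le_of_lt ?_ (half_lt_self hε)
  rw [dist_eq_norm]
  refine CDelta.norm_le_of_incl (by positivity) fun x => ?_
  have hx : ∀ s ∈ Set.uIcc 0 t, ‖k (φ s x) - k x‖ ≤ ε / 2 := by
    intro s hs
    rw [← dist_eq_norm]
    refine (hδk (lt_of_le_of_lt ?_ ht)).le
    have h1 := h.dist_le hM x s 0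
    rw [h.zero] at h1
    have h2 : |s - 0| ≤ |t - 0| := Set.abs_sub_left_of_mem_uIcc hs
    rw [sub_zero t] at h2
    nlinarith [abs_nonneg t, abs_nonneg (s - 0)]
  -- With the linear part removed, the mean value inequality directly bounds the error of the
  -- quotient.
  have hd : ∀ s, HasDerivAt (fun s => F (φ s x) - s * k x) (k (φ s x) - k x) s := fun s => by
    have := (hasDerivAt_comp_flow h (hF.differentiable (by simp)) x s).fun_sub
      ((hasDerivAt_id' s).mul_const (k x))
    rwa [one_mul] at this
  have hmv := (convex_uIcc 0 t).norm_image_sub_le_of_norm_hasDerivWithin_le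
    (fun s _ => (hd s).hasDerivWithinAt) hx Set.left_mem_uIcc Set.right_mem_uIcc
  rw [h.zero, Real.norm_eq_abs, Real.norm_eq_abs, sub_zero t] at hmv
  rw [ContinuousMap.sub_apply, ContinuousMap.smul_apply, ContinuousMap.sub_apply,
    compOperator_apply, extendHomeo_incl, hg, hg, hG, smul_eq_mul]
  change |t⁻¹ * (F (φ t x) - F x) - k x| ≤ ε / 2
  have ht0' : t ≠ 0 := ht0
  have hrw : t⁻¹ * (F (φ t x) - F x) - k x = t⁻¹ * (F (φ t x) - t * k x - (F x - 0 * k x)) := by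
    field_simp
    ring
  rw [hrw, abs_mul, abs_inv, inv_mul_le_iff₀ (abs_pos.mpr ht0'), mul_comm |t|]
  exact hmv

/-- The flow is kept in the conclusion because the sign of the squared generator at maxima is read
off along its trajectories. -/
theorem exists_generator_of_tangent (hE : IsClosed E) (hv : ContDiff ℝ 1 v) (hM : ∀ x, ‖v x‖ ≤ M)
    (htan : ∀ y ∈ E, ∀ z, (∀ u ∈ E, dist z y ≤ dist z u) → inner ℝ (v y) (z - y) = 0) :
    ∃ (φ : ℝ → EuclideanSpace ℝ (Fin d) → EuclideanSpace ℝ (Fin d))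
      (A : CDelta E →ₗ.[ℝ] CDelta E) (T : ℝ → CDelta E →L[ℝ] CDelta E),
      IsFlow v φ ∧ (∀ x ∈ E, ∀ t, φ t x ∈ E) ∧ IsPositiveIsometryGroup T ∧ IsGeneratorOf A T ∧
      ∀ (F : EuclideanSpace ℝ (Fin d) → ℝ) (g G : CDelta E), ContDiff ℝ 1 F →
        HasCompactSupport (fderiv ℝ F) → Represents F g →
        Represents (fun x => fderiv ℝ F x (v x)) G → (g, G) ∈ A.graph := by
  obtain ⟨φ, h⟩ := exists_isFlow hv hM
  have hinv : ∀ x ∈ E, ∀ t, φ t x ∈ E := fun x hx t => h.mem hv hM hE htan hx t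
  obtain ⟨A, hA⟩ := exists_isGeneratorOf
    fun t => compOperator (extendHomeo (flowHomeo h hv hM hinv t))
  refine ⟨φ, A, _, h, hinv, ?_, hA, fun F g G hF hFc hg hG => ?_⟩
  · exact isPositiveIsometryGroup_compOperator (fun x => Subtype.ext (h.zero x))
      (fun s t x => Subtype.ext (h.add hv hM s t x)) (dense_smoothDomain hE)
      fun g hg => continuous_flow_smoothDomain h hv hM hinv hg
  · exact (hA g G).mpr (tendsto_flow_difference_quotient h hv hM hinv hF hFc hg hG)

/-- If `c > 0`, the second derivative test makes `0` a local minimum as well; then `u` is constant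
near `0`, which forces `c = 0`. -/
theorem second_deriv_nonpos_of_max {u u' : ℝ → ℝ} {c : ℝ} (hu : ∀ t, HasDerivAt u (u' t) t)
    (hu' : HasDerivAt u' c 0) (hmax : ∀ t, u t ≤ u 0) : c ≤ 0 := by
  by_contra! hc
  have hderiv : deriv u = u' := funext fun t => (hu t).deriv
  have h0 : u' 0 = 0 := (IsLocalMax.hasDerivAt_eq_zero (Eventually.of_forall hmax) (hu 0))
  have hmin : IsLocalMin u 0 := isLocalMin_of_deriv_deriv_pos
    (by rwa [hderiv, hu'.deriv]) (by rw [hderiv, h0]) (hu 0).continuousAt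
  have hconst : u =ᶠ[𝓝 0] fun _ => u 0 := by
    filter_upwards [hmin] with t ht using le_antisymm (hmax t) ht
  have hz : u' =ᶠ[𝓝 0] fun _ => 0 := by
    rw [← hderiv]
    simpa using hconst.deriv
  exact hc.ne' (hu'.unique ((hasDerivAt_const (0 : ℝ) (0 : ℝ)).congr_of_eventuallyEq hz))

end Tangent

/-! ### The columns of `τ` -/

section Columns

variable {d : ℕ} {E : Set (EuclideanSpace ℝ (Fin d))}
  {τ : EuclideanSpace ℝ (Fin d) → Matrix (Fin d) (Fin d) ℝ}

/-- The vector field given by the `i`-th column of `τ`. -/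
def colField (τ : EuclideanSpace ℝ (Fin d) → Matrix (Fin d) (Fin d) ℝ) (i : Fin d)
    (x : EuclideanSpace ℝ (Fin d)) : EuclideanSpace ℝ (Fin d) :=
  WithLp.toLp 2 fun j => τ x j i

theorem colDeriv_eq_fderiv (i : Fin d) (F : EuclideanSpace ℝ (Fin d) → ℝ) :
    colDeriv τ i F = fun x => fderiv ℝ F x (colField τ i x) := by
  ext x
  rw [← InnerProductSpace.toDual_symm_apply, PiLp.inner_apply]
  simp [colDeriv, tauGrad, Matrix.mulVec, dotProduct, colField, gradient]

theorem contDiff_colField (hτ : τ ∈ SigmaTangent E) (i : Fin d) : ContDiff ℝ 1 (colField τ i) :=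
  contDiff_euclidean.mpr fun j => hτ.1 j i

theorem exists_norm_colField_le (hτ : τ ∈ SigmaTangent E) (i : Fin d) :
    ∃ M, ∀ x, ‖colField τ i x‖ ≤ M := by
  choose f hf using hτ.2.1
  refine ⟨√(∑ j, ‖f j i‖ ^ 2), fun x => ?_⟩
  rw [EuclideanSpace.norm_eq]
  refine Real.sqrt_le_sqrt (Finset.sum_le_sum fun j _ => pow_le_pow_left₀ (norm_nonneg _) ?_ 2)
  change ‖τ x j i‖ ≤ _
  rw [← hf]
  exact (f j i).norm_coe_le_norm _

/-- Membership in `Σ^d(E)` gives orthogonality of the columns to the proximal normals of `E`. -/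
theorem inner_colField_proximal_normal (hτ : τ ∈ SigmaTangent E) (i : Fin d)
    {y : EuclideanSpace ℝ (Fin d)} (hy : y ∈ E) (z : EuclideanSpace ℝ (Fin d))
    (hz : ∀ u ∈ E, dist z y ≤ dist z u) : inner ℝ (colField τ i y) (z - y) = 0 := by
  set R := dist z y + 1 with hR
  have hR0 : 0 < R := by positivity
  have hyR : dist y z < R := by rw [dist_comm, hR]; linarith
  -- The cutoff is `1` on the ball of radius `R` and, as `R > dist z y`, near `y`. Beyond radius `R`
  -- the product is nonpositive, so cutting off creates no larger value than the positive one at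
  -- `y`.
  let χ : ContDiffBump z := ⟨R, R + 1, hR0, by linarith⟩
  set F : EuclideanSpace ℝ (Fin d) → ℝ := fun u => χ u * (R ^ 2 - ‖u - z‖ ^ 2) with hF
  have hFt : IsConstAddTest F := by
    refine ⟨0, F, ?_, χ.hasCompactSupport.mul_right, by simp⟩
    exact χ.contDiff.mul (contDiff_const.sub ((contDiff_id.sub contDiff_const).norm_sq ℝ))
  have hnear : ∀ u, dist u z ≤ R → F u = R ^ 2 - dist u z ^ 2 := fun u hu => by
    rw [hF, dist_eq_norm]
    simp only
    rw [χ.one_of_mem_closedBall hu, one_mul]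
  have hmax : ∀ u ∈ E, F u ≤ F y := by
    intro u hu
    have h1 := hz u hu
    rw [dist_comm z y, dist_comm z u] at h1
    rw [hnear y hyR.le]
    rcases le_total (dist u z) R with h | h
    · rw [hnear u h]
      have := pow_le_pow_left₀ dist_nonneg h1 2
      linarith
    · have h2 : F u ≤ 0 := by
        refine mul_nonpos_of_nonneg_of_nonpos χ.nonneg ?_
        rw [← dist_eq_norm]
        have := pow_le_pow_left₀ hR0.le h 2
        linarith
      have := pow_le_pow_left₀ dist_nonneg hyR.le 2
      linarith
  have hd : HasFDerivAt F (-(2 • (innerSL ℝ (y - z)).comp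
      (ContinuousLinearMap.id ℝ (EuclideanSpace ℝ (Fin d))))) y := by
    refine HasFDerivAt.congr_of_eventuallyEq (f := fun u => R ^ 2 - ‖u - z‖ ^ 2)
      (((hasFDerivAt_id y).sub_const z).norm_sq.const_sub (R ^ 2)) ?_
    filter_upwards [Metric.isOpen_ball.mem_nhds (Metric.mem_ball.mpr hyR)] with u hu
    rw [hnear u (Metric.mem_ball.mp hu).le, dist_eq_norm]
  have h0 : colDeriv τ i F y = 0 := congrFun (hτ.2.2 F hFt y hy hmax) i
  rw [colDeriv_eq_fderiv] at h0
  simp only [hd.fderiv] at h0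
  simp only [ContinuousLinearMap.comp_id, neg_apply, smul_apply, innerSL_apply_apply,
    nsmul_eq_mul, neg_eq_zero, mul_eq_zero] at h0
  have h1 : inner ℝ (y - z) (colField τ i y) = 0 := by simpa using h0
  rw [real_inner_comm, ← neg_sub, inner_neg_left, h1, neg_zero]

theorem IsConstAddTest.hasCompactSupport_fderiv {F : EuclideanSpace ℝ (Fin d) → ℝ}
    (hF : IsConstAddTest F) : HasCompactSupport (fderiv ℝ F) := by
  obtain ⟨c, φ, -, hc, rfl⟩ := hF
  have : fderiv ℝ (fun x => c + φ x) = fderiv ℝ φ := funext fun x => fderiv_const_add c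
  rw [this]
  exact hc.fderiv ℝ

theorem contDiff_colDeriv (hτ : τ ∈ SigmaTangent E) (i : Fin d)
    {F : EuclideanSpace ℝ (Fin d) → ℝ} (hF : IsConstAddTest F) :
    ContDiff ℝ 1 (colDeriv τ i F) := by
  rw [colDeriv_eq_fderiv]
  exact (hF.contDiff.fderiv_right (m := 1) (by norm_cast)).clm_apply (contDiff_colField hτ i)

theorem hasCompactSupport_colDeriv (i : Fin d) {F : EuclideanSpace ℝ (Fin d) → ℝ}
    (hF : HasCompactSupport (fderiv ℝ F)) : HasCompactSupport (colDeriv τ i F) := by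
  rw [colDeriv_eq_fderiv]
  exact hasCompactSupport_lieDeriv hF

theorem exists_represents_colDeriv (hE : IsClosed E) (hτ : τ ∈ SigmaTangent E) (i : Fin d)
    {F : EuclideanSpace ℝ (Fin d) → ℝ} (hF : ContDiff ℝ 1 F)
    (hFc : HasCompactSupport (fderiv ℝ F)) :
    ∃ G : CDelta E, Represents (colDeriv τ i F) G := by
  refine exists_represents hE (c := 0) ?_ (by simpa using hasCompactSupport_colDeriv i hFc)
  rw [colDeriv_eq_fderiv]
  exact continuous_lieDeriv (contDiff_colField hτ i).continuous hF

/-- The columns of `τ ∈ Σ^d(E)` generate groups of positive isometries, and their generators and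
the squares of these act on `D` as differential operators; the squares are nonpositive at maxima. -/
theorem exists_column_generator (hE : IsClosed E) (hτ : τ ∈ SigmaTangent E) (i : Fin d) :
    ∃ A : CDelta E →ₗ.[ℝ] CDelta E,
      (∃ T, IsPositiveIsometryGroup T ∧ IsGeneratorOf A T) ∧
      (∀ F (g : CDelta E), IsConstAddTest F → Represents F g →
        ∃ G G' : CDelta E, Represents (colDeriv τ i F) G ∧
          Represents (colDeriv τ i (colDeriv τ i F)) G' ∧ (g, G) ∈ A.graph ∧ (G, G') ∈ A.graph) ∧
      ∀ F, IsConstAddTest F → ∀ x ∈ E, (∀ y ∈ E, F y ≤ F x) →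
        colDeriv τ i (colDeriv τ i F) x ≤ 0 := by
  obtain ⟨M, hM⟩ := exists_norm_colField_le hτ i
  have hv := contDiff_colField hτ i
  obtain ⟨φ, A, T, hφ, hinv, hT, hA, hgraph⟩ := exists_generator_of_tangent hE hv hM
    (fun y hy z hz => inner_colField_proximal_normal hτ i hy z hz)
  simp only [← colDeriv_eq_fderiv] at hgraph
  refine ⟨A, ⟨T, hT, hA⟩, fun F g hF hg => ?_, fun F hF x hx hmax => ?_⟩
  · have hF1 : ContDiff ℝ 1 F := hF.contDiff.of_le (by norm_cast)
    have hk := contDiff_colDeriv hτ i hF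
    have hkc := (hasCompactSupport_colDeriv (τ := τ) i hF.hasCompactSupport_fderiv).fderiv ℝ
    obtain ⟨G, hG⟩ := exists_represents_colDeriv hE hτ i hF1 hF.hasCompactSupport_fderiv
    obtain ⟨G', hG'⟩ := exists_represents_colDeriv hE hτ i hk hkc
    exact ⟨G, G', hG, hG', hgraph F g G hF1 hF.hasCompactSupport_fderiv hg hG,
      hgraph _ G G' hk hkc hG hG'⟩
  -- The first two derivatives of `F` along the flow line are the iterated column derivatives there;
  -- the line stays in `E`, so `t = 0` is a maximum.
  · have h1 := hasDerivAt_comp_flow hφ (hF.contDiff.differentiable (by simp)) x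
    have h2 := hasDerivAt_comp_flow hφ ((contDiff_colDeriv hτ i hF).differentiable (by simp)) x 0
    rw [hφ.zero] at h2
    rw [colDeriv_eq_fderiv i (colDeriv τ i F)]
    refine second_deriv_nonpos_of_max h1 (h2.congr_of_eventuallyEq ?_) fun t => ?_
    · exact Eventually.of_forall fun t => (congrFun (colDeriv_eq_fderiv i F) _).symm
    · rw [hφ.zero]
      exact hmax _ (hinv x hx t)

end Columns

end MeasureValued

/-! ### The main theorem -/

open MeasureValued in
theorem mainTheorem9 (d : ℕ) (E : Set (EuclideanSpace ℝ (Fin d))) (hE : IsClosed E)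
    (L : MeasPolyD (smoothDomain E) →ₗ[ℝ] MeasPoly E)
    (B : smoothDomain E →ₗ[ℝ] CDelta E)
    (Q : tensorSpace (smoothDomain E) →ₗ[ℝ] SymCDelta E 2)
    (hL : HasForm L B Q)
    (hB_cons : IsConservative B)
    (hB_one : B ⟨1, one_mem_smoothDomain E⟩ = 0)
    (α : E → E → ℝ) (hα_nonneg : ∀ x y, 0 ≤ α x y) (hα_symm : ∀ x y, α x y = α y x)
    (τ : EuclideanSpace ℝ (Fin d) → Matrix (Fin d) (Fin d) ℝ) (hτ : τ ∈ SigmaTangent E)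
    (hQ : ∀ (F : EuclideanSpace ℝ (Fin d) → ℝ) (g : smoothDomain E),
      IsConstAddTest F → Represents F (g : CDelta E) → ∀ x y : E,
        (Q (tensorSelfIn (smoothDomain E) g) : C(Fin 2 → EDelta E, ℝ)) ![incl x, incl y] =
          α x y * Psi (fun u v : E => F u * F v) x y +
            Matrix.trace (Matrix.vecMulVec (tauGrad τ F x) (tauGrad τ F y)))
    (c : ℝ) (hc : 1 / 2 ≤ c)
    (hpmp : PositiveMaximumPrinciple (Set.univ : Set E)
      {G | ∃ (F : EuclideanSpace ℝ (Fin d) → ℝ) (g : smoothDomain E),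
        IsConstAddTest F ∧ Represents F (g : CDelta E) ∧
          G = (fun x : E => F x,
            fun x : E => B g (incl x) - c * ∑ i, colDeriv τ i (colDeriv τ i F) x)}) :
    ∃ A : Fin d → CDelta E →ₗ.[ℝ] CDelta E,
      (∀ (i : Fin d) (F : EuclideanSpace ℝ (Fin d) → ℝ) (g : CDelta E),
        IsConstAddTest F → Represents F g →
          ∃ hg : g ∈ (A i).domain, ∀ x : E, A i ⟨g, hg⟩ (incl x) = colDeriv τ i F x) ∧
      ExistenceConditions (smoothDomain E) L B Q α A := by
  have : LocallyCompactSpace E := hE.isClosedEmbedding_subtypeVal.locallyCompactSpace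
  choose A hgen hA hneg using exists_column_generator hE hτ
  have hdom : ∀ i, smoothDomain E ≤ (A i).domain := by
    rintro i g ⟨F, hF, hg⟩
    obtain ⟨G, -, -, -, h, -⟩ := hA i F g hF hg
    exact LinearPMap.mem_domain_of_mem_graph h
  -- Since the graph of `A i` is single-valued, the column derivative on `E` does not depend on
  -- which extension `F` of `g` is used.
  have hrep : ∀ i F (g : smoothDomain E), IsConstAddTest F → Represents F (g : CDelta E) →
      Represents (colDeriv τ i F) (restrictTo (A i) (hdom i) g) := by
    intro i F g hF hg
    obtain ⟨G, -, hG, -, h, -⟩ := hA i F g hF hg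
    have heq : restrictTo (A i) (hdom i) g = G :=
      (A i).mem_graph_snd_inj ((A i).mem_graph ⟨g, hdom i g.2⟩) h rfl
    rwa [heq]
  have hsq : ∀ i (g : smoothDomain E), restrictTo (A i) (hdom i) g ∈ (A i).domain := by
    intro i g
    obtain ⟨F, hF, hg⟩ := g.2
    obtain ⟨G, G', hG, -, -, h⟩ := hA i F g hF hg
    rw [(hrep i F g hF hg).unique hG]
    exact LinearPMap.mem_domain_of_mem_graph h
  have hrep2 : ∀ i F (g : smoothDomain E), IsConstAddTest F → Represents F (g : CDelta E) →
      Represents (colDeriv τ i (colDeriv τ i F))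
        (A i ⟨restrictTo (A i) (hdom i) g, hsq i g⟩) := by
    intro i F g hF hg
    obtain ⟨G, G', hG, hG', -, h⟩ := hA i F g hF hg
    have heq : A i ⟨restrictTo (A i) (hdom i) g, hsq i g⟩ = G' :=
      (A i).mem_graph_snd_inj ((A i).mem_graph ⟨_, hsq i g⟩) h ((hrep i F g hF hg).unique hG)
    rwa [heq]
  refine ⟨A, fun i F g hF hg => ⟨hdom i ⟨F, hF, hg⟩, hrep i F ⟨g, F, hF, hg⟩ hF hg⟩,
    dense_smoothDomain hE, one_mem_smoothDomain E, hL, hB_cons, hB_one, hα_nonneg, hα_symm, hgen,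
    hdom, hsq, ?_, ?_⟩
  · intro g x y
    -- Both sides are linear in `g`, so the identity reduces to the tensors `g ⊗ g`, where it is
    -- `hQ`.
    obtain ⟨r, rfl⟩ := tensorComb_surjective _ g
    induction r using Finsupp.induction_linear with
    | zero => simp [Psi]
    | add r s hr hs =>
      simp only [map_add, Submodule.coe_add, ContinuousMap.add_apply, hr, hs, Psi,
        Finset.sum_add_distrib]
      ring
    | single g a =>
      have hs : tensorComb (smoothDomain E) (Finsupp.single g a) =
          a • tensorSelfIn (smoothDomain E) g := by simp [tensorComb]
      obtain ⟨F, hF, hg⟩ := g.2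
      have h1 := hQ F g hF hg x y
      have h2 : ∀ i, tensorOp (restrictTo (A i) (hdom i)) (tensorSelfIn (smoothDomain E) g)
          ![incl x, incl y] = tauGrad τ F x i * tauGrad τ F y i := by
        intro i
        rw [tensorOp_tensorSelfIn]
        exact congrArg₂ (· * ·) (hrep i F g hF hg x) (hrep i F g hF hg y)
      have h3 : ∀ u w : E, (tensorSelfIn (smoothDomain E) g : C(Fin 2 → EDelta E, ℝ))
          ![incl u, incl w] = F u * F w := fun u w => congrArg₂ (· * ·) (hg u) (hg w)
      rw [hs]
      simp only [map_smul, Submodule.coe_smul, ContinuousMap.smul_apply, smul_eq_mul, h1, h2, h3,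
        Psi, Matrix.trace, Matrix.diag, Matrix.vecMulVec_apply, ← Finset.mul_sum]
      ring
  · rintro f h ⟨g, hgf⟩ p - hmax h0
    obtain ⟨rfl, rfl⟩ := Prod.mk.inj hgf
    obtain ⟨F, hF, hg⟩ := g.2
    set H : CDelta E := B g - (1 / 2 : ℝ) • ∑ i, A i ⟨restrictTo (A i) (hdom i) g, hsq i g⟩ with hH
    have hHp : ∀ q, H q =
        B g q - (1 / 2) * ∑ i, A i ⟨restrictTo (A i) (hdom i) g, hsq i g⟩ q := by
      simp [hH]
    -- At a maximum, `B - (1/2) ∑ A_i²` is `B - c ∑ A_i²` plus `(c - 1/2) ∑ A_i²`, and both are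
    -- nonpositive.
    have key : ∀ y : E, (∀ z : E, F z ≤ F y) → 0 ≤ F y → H (incl y) ≤ 0 := by
      intro y hy hy0
      have h1 := hpmp _ _ ⟨F, g, hF, hg, rfl⟩ y trivial (fun z _ => hy z) hy0
      have h2 : ∑ i, colDeriv τ i (colDeriv τ i F) y ≤ 0 :=
        Finset.sum_nonpos fun i _ => hneg i F hF y y.2 fun z hz => hy ⟨z, hz⟩
      have h3 : ∑ i, A i ⟨restrictTo (A i) (hdom i) g, hsq i g⟩ (incl y) =
          ∑ i, colDeriv τ i (colDeriv τ i F) y :=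
        Finset.sum_congr rfl fun i _ => hrep2 i F g hF hg y
      rw [hHp, h3]
      nlinarith
    refine (hHp p).symm.le.trans ?_
    have hgF : ∀ z : E, F z ≤ (g : CDelta E) p := fun z => hg z ▸ hmax (incl z) trivial
    by_cases hp : ∃ y : E, p = incl y
    · obtain ⟨y, rfl⟩ := hp
      rw [hg y] at hgF
      exact key y hgF (hg y ▸ h0)
    -- Here `p` is at infinity: `F` takes the maximal value `b` off a compact set, so `key` applies
    -- at all those points and continuity of `H` carries the bound to `p`.
    · push Not at hp
      obtain ⟨b, hb⟩ := hF.exists_const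
      have hK := isCompact_preimage_val hE hb
      have hFb : ∀ y : E, y ∉ ((↑) ⁻¹' tsupport (fun x => F x - b) : Set E) → F y = b :=
        fun y hy => sub_eq_zero.mp (image_eq_zero_of_notMem_tsupport (f := fun x => F x - b) hy)
      have hgp : (g : CDelta E) p = b := mem_of_eventually_mem (g : CDelta E).continuous
        isClosed_singleton hK hp fun y hy => (hg y).trans (hFb y hy)
      refine mem_of_eventually_mem H.continuous isClosed_Iic hK hp fun y hy => key y ?_ ?_
      · rw [hFb y hy, ← hgp]
        exact hgF
      · rw [hFb y hy, ← hgp]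
        exact h0
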